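/- Let $M$ be a closed $C^\infty$ manifold (compact, without boundary) of dimension $d$, endowed with the distance $\mathrm{dist}$ induced by a Riemannian metric (points in different components, if any, being at distance $\infty$), and let $f:M\to M$ be a $C^1$ diffeomorphism. Definitions. A point $p\in M$ is periodic if $f^n(p)=p$ for some $n\ge 1$; its orbit is $\mathcal O(p)=\{f^i(p): i\in\mathbb Z\}$. A periodic point $p$ is hyperbolic if over $\mathcal O(p)$ there is a splitting $TM=E^s\oplus E^u$ into $Df$-invariant subbundles such that, for some $N\ge 1$, $\|Df^N(x)v\|<\tfrac12$ for all $x\in\mathcal O(p)$ and all unit $v\in E^s_x$, and, likewise, for some $N'\geq 1$, $\|Df^{-N'}(x)v\|<\tfrac12$ for all $x\in\mathcal O(p)$ and all unit $v\in E^u_x$. The index of $p$ is $\dim E^s_p$. For a hyperbolic periodic point $p$ put $W^s(p)=\{y: \mathrm{dist}(f^n(y),f^n(p))\to0,\ n\to+\infty\}$ and $W^u(p)=\{y: \mathrm{dist}(f^{-n}(y),f^{-n}(p))\to0,\ n\to+\infty\}$; these are injectively immersed $C^1$ submanifolds. The diffeomorphism $f$ is Kupka--Smale if all its periodic points are hyperbolic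 and, for all periodic points $p,q$, the manifolds $W^s(p)$ and $W^u(q)$ are transversal, i.e. $T_zW^s(p)+T_zW^u(q)=T_zM$ for every $z\in W^s(p)\cap W^u(q)$. Finally, $f$ has the two-sided limit shadowing property if for every sequence $(x_i)_{i\in\mathbb Z}$ in $M$ with $\mathrm{dist}(f(x_i),x_{i+1})\to0$ as $|i|\to\infty$ there is $y\in M$ with $\mathrm{dist}(f^i(y),x_i)\to0$ as $|i|\to\infty$. Corollary. If $f$ is Kupka--Smale and has the two-sided limit shadowing property, then all its periodic points (which are all hyperbolic) have the same index. -/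

import Mathlib

open Set Filter Topology Manifold ContDiff Bundle

noncomputable section

/-- `(xᵢ)_{i ∈ ℤ}` is a two-sided limit pseudo-orbit of the bijection `f`:
`d(f(xᵢ), xᵢ₊₁) → 0` as `|i| → ∞` (which is convergence along the cofinite filter of `ℤ`). -/
def IsTwoSidedLimitPseudoOrbit {X : Type*} [PseudoEMetricSpace X] (f : Equiv.Perm X)
    (x : ℤ → X) : Prop :=
  Tendsto (fun i : ℤ => edist (f (x i)) (x (i + 1))) cofinite (𝓝 0)

/-- `f` has the two-sided limit shadowing property: for every two-sided limit pseudo-orbit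
there is a point `y` with `d(fⁱ(y), xᵢ) → 0` as `|i| → ∞`. -/
def HasTwoSidedLimitShadowing {X : Type*} [PseudoEMetricSpace X] (f : Equiv.Perm X) : Prop :=
  ∀ x : ℤ → X, IsTwoSidedLimitPseudoOrbit f x →
    ∃ y : X, Tendsto (fun i : ℤ => edist ((f ^ i) y) (x i)) cofinite (𝓝 0)

/-- The stable set `W^s(p)` of a point; the unstable set `W^u(p)` is the stable set of `f⁻¹`. -/
def stableSet {X : Type*} [PseudoEMetricSpace X] (f : Equiv.Perm X) (p : X) : Set X :=
  {y | Tendsto (fun n : ℕ => edist (f^[n] y) (f^[n] p)) atTop (𝓝 0)}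

/-- The full orbit `{fⁱ(p) : i ∈ ℤ}`. -/
def fullOrbit {X : Type*} (f : Equiv.Perm X) (p : X) : Set X :=
  range (fun i : ℤ => (f ^ i) p)

section Manifold

variable {d : ℕ} {M : Type*} [EMetricSpace M] [ChartedSpace (EuclideanSpace ℝ (Fin d)) M]

/-- The family `V` of subspaces of the tangent spaces along `Λ` is `Df`-invariant and uniformly
contracted by `f`: for some `N ≥ 1`, `‖Df^N(x) v‖ < 1/2` for all `x ∈ Λ` and unit `v ∈ V x`. -/
def IsUniformlyContracted [RiemannianBundle (fun x : M => TangentSpace (𝓡 d) x)]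
    (f : M ≃ₘ^1⟮𝓡 d, 𝓡 d⟯ M) (Λ : Set M)
    (V : ∀ x : M, Submodule ℝ (TangentSpace (𝓡 d) x)) : Prop :=
  (∀ x ∈ Λ, (V x).map (mfderiv (𝓡 d) (𝓡 d) f x).toLinearMap = V (f x)) ∧
  ∃ N : ℕ, 1 ≤ N ∧ ∀ x ∈ Λ, ∀ v ∈ V x, ‖v‖ = 1 →
    ‖mfderiv (𝓡 d) (𝓡 d) (f^[N]) x v‖ < 1 / 2

/-- `T_Λ M = Es ⊕ Eu` is a hyperbolic splitting over the orbit `Λ` of the periodic point `p`: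
`Es` is uniformly contracted by `f`, and `Eu` by `f⁻¹`. As `Λ` is finite, a subbundle of `T_Λ M`
is just a family of subspaces; its rank is constant along `Λ` by invariance. -/
structure IsHyperbolicSplitting [RiemannianBundle (fun x : M => TangentSpace (𝓡 d) x)]
    (f : M ≃ₘ^1⟮𝓡 d, 𝓡 d⟯ M) (p : M)
    (Es Eu : ∀ x : M, Submodule ℝ (TangentSpace (𝓡 d) x)) : Prop where
  isCompl : ∀ x ∈ fullOrbit f.toEquiv p, IsCompl (Es x) (Eu x)
  stable : IsUniformlyContracted f (fullOrbit f.toEquiv p) Es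
  unstable : IsUniformlyContracted f.symm (fullOrbit f.toEquiv p) Eu

/-- `p` is a hyperbolic periodic point of `f`. -/
def IsHyperbolicPeriodicPt [RiemannianBundle (fun x : M => TangentSpace (𝓡 d) x)]
    (f : M ≃ₘ^1⟮𝓡 d, 𝓡 d⟯ M) (p : M) : Prop :=
  p ∈ Function.periodicPts f ∧ ∃ Es Eu, IsHyperbolicSplitting f p Es Eu

/-- `p` is a hyperbolic periodic point of `f` of index `k`: its stable bundle has rank `k`. -/
def HasIndex [RiemannianBundle (fun x : M => TangentSpace (𝓡 d) x)]
    (f : M ≃ₘ^1⟮𝓡 d, 𝓡 d⟯ M) (p : M) (k : ℕ) : Prop :=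
  p ∈ Function.periodicPts f ∧
    ∃ Es Eu, IsHyperbolicSplitting f p Es Eu ∧ Module.finrank ℝ (Es p) = k

/-- The tangent space at `z` of the stable manifold `W^s(p)` of a hyperbolic periodic point:
the velocities at `z` of `C¹` curves in `W^s(p)`. The stable manifold is only an immersed
submanifold, and the curves have to be continuous for its intrinsic topology, in which compact
pieces of `W^s(p)` are attracted uniformly to the orbit of `p`; hence the convergence
`d(fⁿ(γ(t)), fⁿ(p)) → 0` is required to be uniform in `t`. (A curve that is merely contained in
the set `W^s(p)` may be transverse to the manifold, for instance at the crossing point of a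
figure-eight of homoclinic loops.) -/
def stableTangent (f : M ≃ₘ^1⟮𝓡 d, 𝓡 d⟯ M) (p z : M) : Set (TangentSpace (𝓡 d) z) :=
  {v | ∃ (ε : ℝ) (γ : ℝ → M), 0 < ε ∧ ContMDiffOn 𝓘(ℝ, ℝ) (𝓡 d) 1 γ (Ioo (-ε) ε) ∧
    (⟨γ 0, mfderiv 𝓘(ℝ, ℝ) (𝓡 d) γ 0 (1 : ℝ)⟩ : TangentBundle (𝓡 d) M) = ⟨z, v⟩ ∧
    ∀ η : ENNReal, 0 < η → ∃ N : ℕ, ∀ n ≥ N, ∀ t ∈ Ioo (-ε) ε,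
      edist (f^[n] (γ t)) (f^[n] p) < η}

/-- `W^s(p)` and `W^u(q)` are transversal: `T_z W^s(p) + T_z W^u(q) = T_z M` at every common
point `z`. -/
def StableUnstableTransversal (f : M ≃ₘ^1⟮𝓡 d, 𝓡 d⟯ M) (p q : M) : Prop :=
  ∀ z ∈ stableSet f.toEquiv p ∩ stableSet f.symm.toEquiv q, ∀ w : TangentSpace (𝓡 d) z,
    ∃ u ∈ stableTangent f p z, ∃ v ∈ stableTangent f.symm q z, u + v = w

/-- `f` is Kupka–Smale: all periodic points are hyperbolic, and `W^s(p)` and `W^u(q)` are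
transversal for all periodic points `p` and `q`. -/
def IsKupkaSmale [RiemannianBundle (fun x : M => TangentSpace (𝓡 d) x)]
    (f : M ≃ₘ^1⟮𝓡 d, 𝓡 d⟯ M) : Prop :=
  (∀ p ∈ Function.periodicPts f, IsHyperbolicPeriodicPt f p) ∧
  ∀ p ∈ Function.periodicPts f, ∀ q ∈ Function.periodicPts f, StableUnstableTransversal f p q

end Manifold

end

/-!
Let `p` and `q` be periodic. The sequence that follows the orbit of `q` at negative times and that of
`p` at nonnegative times is a two-sided limit pseudo-orbit, and a shadowing point `z` of it lies in
`W^s(p) ∩ W^u(q)` (`HasTwoSidedLimitShadowing.nonempty_inter`). By transversality the tangent spaces of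
the two manifolds at `z` span, so `d ≤ ind p + (d - ind q)`, that is, `ind q ≤ ind p`
(`finrank_le_of_stableUnstableTransversal`). Exchanging `p` and `q` gives equality. The same inequality
for two splittings at one point shows that the index is well defined.

What has to be supplied is the bound `dim T_z W^s(p) ≤ ind p`, and this does not require the stable
manifold theorem. The cone argument near a hyperbolic fixed point
(`HasStrictFDerivAt.exists_nhds_norm_sub_le_of_hyperbolic`) shows that the local stable set is a
Lipschitz graph over a subset of the stable subspace. Passing to velocities of curves, the set of
tangent vectors of `W^s(p)` at `z` is a Lipschitz graph over a subset of a space of dimension `ind p`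
(`IsHyperbolicSplitting.exists_dist_le_of_mem_stableTangent`). That this set is a linear subspace is
not used: Hausdorff dimension bounds the dimension of a space that is the sum of two such sets
(`finrank_le_add_of_forall_exists_add`). The unstable manifold is the stable manifold of `f⁻¹`.
-/

/-! ### Orbits near a hyperbolic fixed point -/

/-- The cone argument at a hyperbolic fixed point: two orbits that never leave a small neighbourhood
differ by a vector whose unstable component is at most its stable component. Otherwise the unstable
component of the difference would stay dominant and grow by the factor `3 / 2` at every step. Thus
the local stable set is a Lipschitz graph over a subset of `Es`. -/
theorem HasStrictFDerivAt.exists_nhds_norm_sub_le_of_hyperbolic {E : Type*}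
    [NormedAddCommGroup E] [NormedSpace ℝ E] [FiniteDimensional ℝ E] {Es Eu : Submodule ℝ E}
    (h : IsCompl Es Eu) {G : E → E} {A : E →L[ℝ] E} {x₀ : E} (hG : HasStrictFDerivAt G A x₀)
    (hs : ∀ v ∈ Es, A v ∈ Es ∧ ‖A v‖ ≤ 1 / 2 * ‖v‖)
    (hu : ∀ v ∈ Eu, A v ∈ Eu ∧ ‖v‖ ≤ 1 / 2 * ‖A v‖) :
    ∃ U ∈ 𝓝 x₀, ∀ x y : ℕ → E, (∀ n, x n ∈ U ∧ x (n + 1) = G (x n)) →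
      (∀ n, y n ∈ U ∧ y (n + 1) = G (y n)) →
      ‖x 0 - y 0‖ ≤ 2 * ‖Es.projectionOnto Eu h (x 0 - y 0)‖ := by
  set πs : E →L[ℝ] E := LinearMap.toContinuousLinearMap (Es.projection Eu h)
  set πu : E →L[ℝ] E := LinearMap.toContinuousLinearMap (Eu.projection Es h.symm)
  have hadd : ∀ v, πs v + πu v = v := fun v => Submodule.projection_add_projection_eq_self h v
  have hs_mem : ∀ v, πs v ∈ Es := fun v => Submodule.projection_apply_mem h v
  have hu_mem : ∀ v, πu v ∈ Eu := fun v => Submodule.projection_apply_mem h.symm v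
  have hsA : ∀ v, πs (A v) = A (πs v) := by
    intro v
    conv_lhs => rw [← hadd v, map_add, map_add]
    have h1 : πs (A (πs v)) = A (πs v) :=
      Submodule.projection_apply_of_mem_left h (hs _ (hs_mem v)).1
    have h2 : πs (A (πu v)) = 0 :=
      Submodule.projection_apply_of_mem_right h (hu _ (hu_mem v)).1
    rw [h1, h2, add_zero]
  have huA : ∀ v, πu (A v) = A (πu v) := by
    intro v
    have h1 := hadd (A v)
    have h2 := congrArg A (hadd v)
    rw [map_add, ← h1, hsA] at h2
    exact (add_left_cancel h2).symm
  -- the factor `1 / (8 * C)` makes both components of the linearization error at most an eighth of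
  -- the sum of the two components
  set C : ℝ := ‖πs‖ + ‖πu‖ + 1
  have hCpos : 0 < C := by positivity
  obtain ⟨U, hU, hUA⟩ := hG.approximates_deriv_on_nhds (c := ⟨1 / (8 * C), by positivity⟩)
    (Or.inr (show (0 : ℝ) < 1 / (8 * C) by positivity))
  obtain ⟨r, hr, hrU⟩ := Metric.nhds_basis_ball.mem_iff.1 hU
  refine ⟨Metric.ball x₀ r, Metric.ball_mem_nhds _ hr, fun x y hx hy => ?_⟩
  set s : ℕ → ℝ := fun n => ‖πs (x n - y n)‖ with hsdef
  set u : ℕ → ℝ := fun n => ‖πu (x n - y n)‖ with hudef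
  -- one step changes the two components as `A` does, up to an eighth of their sum
  have hstep : ∀ n, s (n + 1) ≤ 1 / 2 * s n + 1 / 8 * (s n + u n) ∧
      2 * u n - 1 / 8 * (s n + u n) ≤ u (n + 1) := by
    intro n
    set e : E := x (n + 1) - y (n + 1) - A (x n - y n) with he
    have hen : ‖e‖ ≤ 1 / (8 * C) * ‖x n - y n‖ := by
      have := hUA _ (hrU (hx n).1) _ (hrU (hy n).1)
      rw [he, (hx n).2, (hy n).2]
      exact this
    have hsum : ‖x n - y n‖ ≤ s n + u n := by
      conv_lhs => rw [← hadd (x n - y n)]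
      exact norm_add_le _ _
    have hCe : C * ‖e‖ ≤ 1 / 8 * (s n + u n) := by
      calc C * ‖e‖ ≤ C * (1 / (8 * C) * (s n + u n)) := by gcongr; exact hen.trans (by gcongr)
        _ = 1 / 8 * (s n + u n) := by field_simp
    have hes : ‖πs e‖ ≤ 1 / 8 * (s n + u n) := by
      refine (πs.le_opNorm e).trans (le_trans ?_ hCe)
      gcongr
      linarith [norm_nonneg πu]
    have heu : ‖πu e‖ ≤ 1 / 8 * (s n + u n) := by
      refine (πu.le_opNorm e).trans (le_trans ?_ hCe)
      gcongr
      linarith [norm_nonneg πs]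
    have hxe : x (n + 1) - y (n + 1) = A (x n - y n) + e := by rw [he]; abel
    constructor
    · have h1 : s (n + 1) = ‖A (πs (x n - y n)) + πs e‖ := by
        simp only [hsdef, hxe, map_add, hsA]
      rw [h1]
      exact (norm_add_le _ _).trans (add_le_add (hs _ (hs_mem _)).2 hes)
    · have h1 : u (n + 1) = ‖A (πu (x n - y n)) + πu e‖ := by
        simp only [hudef, hxe, map_add, huA]
      rw [h1]
      have h2 := norm_sub_le (A (πu (x n - y n)) + πu e) (πu e)
      rw [add_sub_cancel_right] at h2
      have h3 := (hu _ (hu_mem (x n - y n))).2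
      simp only [hudef] at *
      linarith
  have hus : u 0 ≤ s 0 := by
    by_contra! hlt
    have key : ∀ n, s n ≤ u n ∧ (3 / 2) ^ n * u 0 ≤ u n := by
      intro n
      induction n with
      | zero => simpa using hlt.le
      | succ n ih =>
        obtain ⟨h1, h2⟩ := hstep n
        have h0 : 0 ≤ s n := norm_nonneg _
        refine ⟨by linarith, ?_⟩
        rw [pow_succ]
        linarith
    have hpos : 0 < u 0 := (norm_nonneg _).trans_lt hlt
    obtain ⟨n, hn⟩ := pow_unbounded_of_one_lt (C * (2 * r) / u 0) (by norm_num : (1 : ℝ) < 3 / 2)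
    rw [div_lt_iff₀ hpos] at hn
    have hxy : ‖x n - y n‖ ≤ 2 * r := by
      rw [← dist_eq_norm]
      have h1 := Metric.mem_ball.1 (hx n).1
      have h2 := Metric.mem_ball.1 (hy n).1
      linarith [dist_triangle_right (x n) (y n) x₀]
    have hb : u n ≤ C * (2 * r) :=
      (πu.le_opNorm _).trans (mul_le_mul (by linarith [norm_nonneg πs]) hxy (norm_nonneg _) hCpos.le)
    linarith [(key n).2]
  calc ‖x 0 - y 0‖ = ‖πs (x 0 - y 0) + πu (x 0 - y 0)‖ := by rw [hadd]
    _ ≤ s 0 + u 0 := norm_add_le _ _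
    _ ≤ 2 * s 0 := by linarith

/-! ### Dimension of sums of Lipschitz graphs -/

/-- A map which is bounded below on `S` has a Lipschitz inverse on its image of `S`. -/
theorem exists_lipschitzOnWith_leftInvOn {X Y : Type*} [MetricSpace X] [PseudoMetricSpace Y]
    [Nonempty X] {S : Set X} {T : X → Y} {K : NNReal}
    (h : ∀ v ∈ S, ∀ w ∈ S, dist v w ≤ K * dist (T v) (T w)) :
    ∃ g : Y → X, LipschitzOnWith K g (T '' S) ∧ LeftInvOn g T S := by
  have hinj : InjOn T S := fun v hv w hw hvw =>
    dist_le_zero.1 (by simpa [hvw] using h v hv w hw)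
  refine ⟨Function.invFunOn T S, LipschitzOnWith.of_dist_le_mul fun a ha b hb => ?_,
    hinj.leftInvOn_invFunOn⟩
  have := h _ (Function.invFunOn_mem ha) _ (Function.invFunOn_mem hb)
  rwa [Function.invFunOn_eq ha, Function.invFunOn_eq hb] at this

/-- Linearity of `S₁` and `S₂` is not needed to compare dimensions: each `Sᵢ` is the image of a subset
of `Fᵢ` under a Lipschitz map, so the sum set has Hausdorff dimension at most
`dim F₁ + dim F₂`. -/
theorem finrank_le_add_of_forall_exists_add {E F₁ F₂ : Type*}
    [NormedAddCommGroup E] [NormedSpace ℝ E] [FiniteDimensional ℝ E]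
    [NormedAddCommGroup F₁] [NormedSpace ℝ F₁] [FiniteDimensional ℝ F₁]
    [NormedAddCommGroup F₂] [NormedSpace ℝ F₂] [FiniteDimensional ℝ F₂]
    {S₁ S₂ : Set E} {T₁ : E → F₁} {T₂ : E → F₂} {K₁ K₂ : NNReal}
    (h₁ : ∀ v ∈ S₁, ∀ w ∈ S₁, dist v w ≤ K₁ * dist (T₁ v) (T₁ w))
    (h₂ : ∀ v ∈ S₂, ∀ w ∈ S₂, dist v w ≤ K₂ * dist (T₂ v) (T₂ w))
    (h : ∀ w : E, ∃ u ∈ S₁, ∃ v ∈ S₂, u + v = w) :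
    Module.finrank ℝ E ≤ Module.finrank ℝ F₁ + Module.finrank ℝ F₂ := by
  obtain ⟨g₁, hg₁, hinv₁⟩ := exists_lipschitzOnWith_leftInvOn h₁
  obtain ⟨g₂, hg₂, hinv₂⟩ := exists_lipschitzOnWith_leftInvOn h₂
  set P : Set (F₁ × F₂) := (T₁ '' S₁) ×ˢ (T₂ '' S₂)
  have hg : LipschitzOnWith (K₁ * 1 + K₂ * 1) (fun p : F₁ × F₂ => g₁ p.1 + g₂ p.2) P :=
    (hg₁.comp (LipschitzWith.prod_fst.lipschitzOnWith) fun _ hp => hp.1).add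
      (hg₂.comp (LipschitzWith.prod_snd.lipschitzOnWith) fun _ hp => hp.2)
  have himage : (fun p : F₁ × F₂ => g₁ p.1 + g₂ p.2) '' P = univ := by
    refine eq_univ_of_forall fun w => ?_
    obtain ⟨u, hu, v, hv, rfl⟩ := h w
    exact ⟨(T₁ u, T₂ v), ⟨mem_image_of_mem _ hu, mem_image_of_mem _ hv⟩,
      by simp only [hinv₁ hu, hinv₂ hv]⟩
  have hdim := hg.dimH_image_le.trans (dimH_mono (subset_univ P))
  rw [himage, Real.dimH_univ_eq_finrank, Real.dimH_univ_eq_finrank, Module.finrank_prod] at hdim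
  exact_mod_cast hdim

/-! ### Iterates and invariant splittings along a periodic orbit -/

section Iterates

variable {d : ℕ} {M : Type*} [EMetricSpace M] [ChartedSpace (EuclideanSpace ℝ (Fin d)) M]

theorem Diffeomorph.contMDiff_iterate (f : M ≃ₘ^1⟮𝓡 d, 𝓡 d⟯ M) (n : ℕ) :
    ContMDiff (𝓡 d) (𝓡 d) 1 f^[n] := by
  induction n with
  | zero => exact contMDiff_id
  | succ n ih => exact ih.comp f.contMDiff

theorem Diffeomorph.mdifferentiableAt_iterate (f : M ≃ₘ^1⟮𝓡 d, 𝓡 d⟯ M) (n : ℕ) (x : M) :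
    MDifferentiableAt (𝓡 d) (𝓡 d) f^[n] x :=
  (f.contMDiff_iterate n).mdifferentiableAt one_ne_zero

theorem Diffeomorph.symm_iterate_apply_iterate (f : M ≃ₘ^1⟮𝓡 d, 𝓡 d⟯ M) (n : ℕ) (x : M) :
    f.symm^[n] (f^[n] x) = x :=
  (Function.LeftInverse.iterate f.symm_apply_apply n) x

theorem Diffeomorph.mfderiv_iterate_add_apply (f : M ≃ₘ^1⟮𝓡 d, 𝓡 d⟯ M) (m n : ℕ) (x : M)
    (v : TangentSpace (𝓡 d) x) :
    mfderiv (𝓡 d) (𝓡 d) f^[m + n] x v =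
      mfderiv (𝓡 d) (𝓡 d) f^[m] (f^[n] x) (mfderiv (𝓡 d) (𝓡 d) f^[n] x v) := by
  rw [Function.iterate_add, mfderiv_comp x (f.mdifferentiableAt_iterate m _)
    (f.mdifferentiableAt_iterate n x)]
  rfl

theorem Diffeomorph.mfderiv_symm_iterate_apply (f : M ≃ₘ^1⟮𝓡 d, 𝓡 d⟯ M) (n : ℕ) (x : M)
    (v : TangentSpace (𝓡 d) x) :
    mfderiv (𝓡 d) (𝓡 d) f.symm^[n] (f^[n] x) (mfderiv (𝓡 d) (𝓡 d) f^[n] x v) = v := by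
  have h := mfderiv_comp x (f.symm.mdifferentiableAt_iterate n _) (f.mdifferentiableAt_iterate n x)
  have hid : f.symm^[n] ∘ f^[n] = id := funext (f.symm_iterate_apply_iterate n)
  have h2 := DFunLike.congr_fun h v
  rw [hid, mfderiv_id] at h2
  exact h2.symm

theorem fullOrbit_symm (f : M ≃ₘ^1⟮𝓡 d, 𝓡 d⟯ M) (p : M) :
    fullOrbit f.symm.toEquiv p = fullOrbit f.toEquiv p := by
  have h : (f.symm.toEquiv : Equiv.Perm M) = (f.toEquiv : Equiv.Perm M)⁻¹ := rfl
  ext y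
  simp only [fullOrbit, mem_range, h]
  exact ⟨fun ⟨i, hi⟩ => ⟨-i, by rw [← hi, inv_zpow, zpow_neg]⟩,
    fun ⟨i, hi⟩ => ⟨-i, by rw [← hi, inv_zpow, zpow_neg, inv_inv]⟩⟩

theorem iterate_mem_fullOrbit (f : M ≃ₘ^1⟮𝓡 d, 𝓡 d⟯ M) (p : M) (n : ℕ) :
    f^[n] p ∈ fullOrbit f.toEquiv p := by
  refine ⟨n, ?_⟩
  change ((f.toEquiv : Equiv.Perm M) ^ (n : ℤ)) p = (f.toEquiv : Equiv.Perm M)^[n] p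
  rw [zpow_natCast, Equiv.Perm.iterate_eq_pow]

theorem mem_fullOrbit_self (f : M ≃ₘ^1⟮𝓡 d, 𝓡 d⟯ M) (p : M) : p ∈ fullOrbit f.toEquiv p :=
  ⟨0, rfl⟩

theorem mfderiv_iterate_mem {f : M ≃ₘ^1⟮𝓡 d, 𝓡 d⟯ M} {p : M}
    {V : ∀ x : M, Submodule ℝ (TangentSpace (𝓡 d) x)}
    (h : ∀ x ∈ fullOrbit f.toEquiv p, ∀ v ∈ V x, mfderiv (𝓡 d) (𝓡 d) f x v ∈ V (f x))
    (n : ℕ) {v : TangentSpace (𝓡 d) p} (hv : v ∈ V p) :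
    mfderiv (𝓡 d) (𝓡 d) f^[n] p v ∈ V (f^[n] p) := by
  induction n with
  | zero => rw [Function.iterate_zero, mfderiv_id]; exact hv
  | succ n ih =>
    rw [add_comm n 1, f.mfderiv_iterate_add_apply 1 n p v, Function.iterate_add_apply]
    exact h _ (iterate_mem_fullOrbit f p n) _ ih

variable [RiemannianBundle (fun x : M => TangentSpace (𝓡 d) x)]

theorem IsHyperbolicSplitting.symm {f : M ≃ₘ^1⟮𝓡 d, 𝓡 d⟯ M} {p : M}
    {Es Eu : ∀ x : M, Submodule ℝ (TangentSpace (𝓡 d) x)} (h : IsHyperbolicSplitting f p Es Eu) :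
    IsHyperbolicSplitting f.symm p Eu Es where
  isCompl x hx := (h.isCompl x (by rwa [fullOrbit_symm] at hx)).symm
  stable := by rw [fullOrbit_symm]; exact h.unstable
  unstable := by rw [fullOrbit_symm]; exact h.stable

theorem IsUniformlyContracted.mfderiv_mem {f : M ≃ₘ^1⟮𝓡 d, 𝓡 d⟯ M} {Λ : Set M}
    {V : ∀ x : M, Submodule ℝ (TangentSpace (𝓡 d) x)} (h : IsUniformlyContracted f Λ V)
    {x : M} (hx : x ∈ Λ) {v : TangentSpace (𝓡 d) x} (hv : v ∈ V x) :
    mfderiv (𝓡 d) (𝓡 d) f x v ∈ V (f x) := by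
  rw [← h.1 x hx]
  exact Submodule.mem_map_of_mem hv

/-- A family invariant under `D(f⁻¹)` is also carried into itself by `Df`: every `v ∈ V x` is
`D(f⁻¹)(f x) u` for some `u ∈ V (f x)`, and then `Df v = u`. -/
theorem IsUniformlyContracted.mfderiv_mem_of_symm {f : M ≃ₘ^1⟮𝓡 d, 𝓡 d⟯ M} {Λ : Set M}
    {V : ∀ x : M, Submodule ℝ (TangentSpace (𝓡 d) x)} (h : IsUniformlyContracted f.symm Λ V)
    {x : M} (hx : f x ∈ Λ) {v : TangentSpace (𝓡 d) x} (hv : v ∈ V x) :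
    mfderiv (𝓡 d) (𝓡 d) f x v ∈ V (f x) := by
  have h1 := h.1 (f x) hx
  -- `f.symm (f x)` equals `x` only propositionally; tangent vectors are moved between the two
  -- tangent spaces as elements of the model space
  have key : ∀ y, y = x → ∀ w : EuclideanSpace ℝ (Fin d),
      V y = Submodule.map (mfderiv (𝓡 d) (𝓡 d) f.symm (f x)).toLinearMap (V (f x)) →
      (show TangentSpace (𝓡 d) x from w) ∈ V x → ∃ u ∈ V (f x),
        (mfderiv (𝓡 d) (𝓡 d) f.symm (f x) u : EuclideanSpace ℝ (Fin d)) = w := by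
    intro y hy w hV hw
    have hw' : (show TangentSpace (𝓡 d) y from w) ∈ V y := by subst hy; exact hw
    rw [hV] at hw'
    exact hw'
  obtain ⟨u, hu, huv⟩ := key _ (f.symm_apply_apply x) v h1.symm hv
  have h2 := f.symm.mfderiv_symm_iterate_apply 1 (f x) u
  have key2 : ∀ y, y = x → ∀ w : EuclideanSpace ℝ (Fin d),
      (mfderiv (𝓡 d) (𝓡 d) f y w : EuclideanSpace ℝ (Fin d)) = mfderiv (𝓡 d) (𝓡 d) f x w := by
    rintro y rfl w; rfl
  have h3 : (mfderiv (𝓡 d) (𝓡 d) f x v : EuclideanSpace ℝ (Fin d)) = u := by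
    rw [← h2]
    refine (key2 _ (f.symm_apply_apply x) v).symm.trans ?_
    exact congrArg (mfderiv (𝓡 d) (𝓡 d) f (f.symm (f x))) huv.symm
  have h4 : mfderiv (𝓡 d) (𝓡 d) f x v = u := h3
  rw [h4]
  exact hu

theorem IsUniformlyContracted.exists_norm_mfderiv_iterate_le {f : M ≃ₘ^1⟮𝓡 d, 𝓡 d⟯ M} {p : M}
    {V : ∀ x : M, Submodule ℝ (TangentSpace (𝓡 d) x)}
    (h : IsUniformlyContracted f (fullOrbit f.toEquiv p) V) :
    ∃ N, 1 ≤ N ∧ ∀ k, ∀ v ∈ V p,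
      ‖mfderiv (𝓡 d) (𝓡 d) f^[N * k] p v‖ ≤ (1 / 2) ^ k * ‖v‖ := by
  obtain ⟨N, hN, hc⟩ := h.2
  have hc' : ∀ x ∈ fullOrbit f.toEquiv p, ∀ v ∈ V x,
      ‖mfderiv (𝓡 d) (𝓡 d) f^[N] x v‖ ≤ 1 / 2 * ‖v‖ := by
    intro x hx v hv
    rcases eq_or_ne v 0 with rfl | hv0
    · simp
    have hpos : 0 < ‖v‖ := norm_pos_iff.2 hv0
    have h1 := (hc x hx (‖v‖⁻¹ • v) ((V x).smul_mem _ hv)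
      (by rw [norm_smul, norm_inv, norm_norm, inv_mul_cancel₀ hpos.ne'])).le
    rw [map_smul, norm_smul, norm_inv, norm_norm] at h1
    rwa [inv_mul_le_iff₀ hpos, mul_comm] at h1
  refine ⟨N, hN, fun k => ?_⟩
  induction k with
  | zero =>
    intro v _
    rw [mul_zero, Function.iterate_zero, mfderiv_id]
    simp
  | succ k ih =>
    intro v hv
    rw [mul_add, mul_one, add_comm, f.mfderiv_iterate_add_apply N (N * k) p v,
      Function.iterate_add_apply]
    refine (hc' _ (iterate_mem_fullOrbit f p _) _
      (mfderiv_iterate_mem (fun x hx v hv => h.mfderiv_mem hx hv) _ hv)).trans ?_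
    rw [pow_succ]
    linarith [ih v hv]

/-- The Riemannian norm on the tangent space at `p` is equivalent to the norm of the model space.
The norm instance on `TangentSpace` is the Riemannian one, so the model norm is named explicitly. -/
theorem exists_tangent_norm_equiv (p : M) : ∃ C : ℝ, 0 < C ∧
    (∀ v : TangentSpace (𝓡 d) p, ‖v‖ ≤ C * @norm (EuclideanSpace ℝ (Fin d)) _ v) ∧
    (∀ v : TangentSpace (𝓡 d) p, @norm (EuclideanSpace ℝ (Fin d)) _ v ≤ C * ‖v‖) := by
  let i : EuclideanSpace ℝ (Fin d) →L[ℝ] TangentSpace (𝓡 d) p :=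
    ContinuousLinearMap.id ℝ (EuclideanSpace ℝ (Fin d))
  let j : TangentSpace (𝓡 d) p →L[ℝ] EuclideanSpace ℝ (Fin d) :=
    ContinuousLinearMap.id ℝ (EuclideanSpace ℝ (Fin d))
  refine ⟨‖i‖ + ‖j‖ + 1, by positivity, fun v => ?_, fun v => ?_⟩
  · exact (i.le_opNorm v).trans
      (mul_le_mul_of_nonneg_right (by linarith [norm_nonneg j]) (norm_nonneg _))
  · exact (j.le_opNorm v).trans
      (mul_le_mul_of_nonneg_right (by linarith [norm_nonneg i]) (norm_nonneg _))

/-- At a periodic point, a sufficiently high return map contracts in the norm of the model space as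
well, since the constants comparing it with the Riemannian norm are absorbed by the powers of
`1 / 2`. -/
theorem IsUniformlyContracted.exists_euclidean_norm_le {f : M ≃ₘ^1⟮𝓡 d, 𝓡 d⟯ M} {p : M}
    {V : ∀ x : M, Submodule ℝ (TangentSpace (𝓡 d) x)}
    (h : IsUniformlyContracted f (fullOrbit f.toEquiv p) V) :
    ∃ N, 1 ≤ N ∧ ∀ n, N ∣ n → 1 ≤ n → f^[n] p = p → ∀ v ∈ V p,
      @norm (EuclideanSpace ℝ (Fin d)) _ (mfderiv (𝓡 d) (𝓡 d) f^[n] p v) ≤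
        1 / 2 * @norm (EuclideanSpace ℝ (Fin d)) _ v := by
  obtain ⟨N, hN, hc⟩ := h.exists_norm_mfderiv_iterate_le
  obtain ⟨C, hC, h1, h2⟩ := exists_tangent_norm_equiv (d := d) p
  obtain ⟨J, hJ⟩ := exists_pow_lt_of_lt_one (show 0 < 1 / (2 * C ^ 2) by positivity)
    (show (1 / 2 : ℝ) < 1 by norm_num)
  refine ⟨N * (J + 1), by nlinarith, ?_⟩
  rintro _ ⟨c, rfl⟩ hn hper v hv
  have hc1 : 1 ≤ c := Nat.one_le_iff_ne_zero.2 fun h0 => by simp [h0] at hn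
  rw [mul_assoc] at hper ⊢
  set k := (J + 1) * c
  have hk : J ≤ k := (Nat.le_succ J).trans (Nat.le_mul_of_pos_right _ hc1)
  have hpow : (1 / 2 : ℝ) ^ k ≤ 1 / (2 * C ^ 2) :=
    (pow_le_pow_of_le_one (by norm_num) (by norm_num) hk).trans hJ.le
  have h2' : ∀ y, y = p → ∀ w : EuclideanSpace ℝ (Fin d),
      ‖w‖ ≤ C * ‖(show TangentSpace (𝓡 d) y from w)‖ := by
    rintro y rfl w; exact h2 w
  calc _ ≤ C * ‖mfderiv (𝓡 d) (𝓡 d) f^[N * k] p v‖ := h2' _ hper _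
    _ ≤ C * ((1 / 2) ^ k * ‖v‖) := by gcongr; exact hc k v hv
    _ ≤ C * (1 / (2 * C ^ 2) * (C * @norm (EuclideanSpace ℝ (Fin d)) _ v)) := by
      gcongr
      exact h1 v
    _ = _ := by field_simp

end Iterates

/-! ### Tangent vectors of the stable manifold -/

/-- A closed cone that contains a curve issuing from its vertex contains the velocity there. -/
theorem HasDerivAt.norm_le_of_eventually_norm_le {E F : Type*} [NormedAddCommGroup E]
    [NormedSpace ℝ E] [NormedAddCommGroup F] [NormedSpace ℝ F] {h : ℝ → E} {h' : E}
    (hh : HasDerivAt h h' 0) (h0 : h 0 = 0) (B : E →L[ℝ] F) {c : ℝ}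
    (hB : ∀ᶠ t in 𝓝 0, ‖h t‖ ≤ c * ‖B (h t)‖) : ‖h'‖ ≤ c * ‖B h'‖ := by
  have ht := hasDerivAt_iff_tendsto_slope.1 hh
  refine le_of_tendsto_of_tendsto ht.norm (((B.continuous.tendsto _).comp ht).norm.const_mul c) ?_
  filter_upwards [hB.filter_mono nhdsWithin_le_nhds] with t hbt
  simp only [slope_def_module, h0, sub_zero, Function.comp_apply, map_smul, norm_smul]
  calc ‖t⁻¹‖ * ‖h t‖ ≤ ‖t⁻¹‖ * (c * ‖B (h t)‖) := by gcongr
    _ = c * (‖t⁻¹‖ * ‖B (h t)‖) := by ring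

section Chart

variable {d : ℕ} {M : Type*} [EMetricSpace M] [ChartedSpace (EuclideanSpace ℝ (Fin d)) M]

/-- If the orbit of `γ 0` stays `η`-close to that of `p` from time `N` on, then so do the orbits of
all `γ t` with `t` small, with the same `N`: late times are covered by uniform convergence along the
curve, and the finitely many remaining times by continuity. -/
theorem eventually_forall_edist_iterate_lt (f : M ≃ₘ^1⟮𝓡 d, 𝓡 d⟯ M) {p : M} {γ : ℝ → M}
    {ε : ℝ} (hε : 0 < ε) (hγ : ContinuousAt γ 0)
    (hunif : ∀ η : ENNReal, 0 < η → ∃ N : ℕ, ∀ n ≥ N, ∀ t ∈ Ioo (-ε) ε,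
      edist (f^[n] (γ t)) (f^[n] p) < η)
    {η : ENNReal} (hη : 0 < η) {N : ℕ} (hN : ∀ n ≥ N, edist (f^[n] (γ 0)) (f^[n] p) < η) :
    ∀ᶠ t in 𝓝 0, ∀ n ≥ N, edist (f^[n] (γ t)) (f^[n] p) < η := by
  obtain ⟨N', hN'⟩ := hunif η hη
  have h1 : ∀ᶠ t in 𝓝 (0 : ℝ), ∀ n ∈ Finset.Ico N N', edist (f^[n] (γ t)) (f^[n] p) < η := by
    rw [Filter.eventually_all_finset]
    intro n hn
    have hcont : ContinuousAt (fun t => edist (f^[n] (γ t)) (f^[n] p)) 0 :=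
      (((f.continuous.iterate n).continuousAt.comp hγ)).edist continuousAt_const
    exact hcont.eventually_lt continuousAt_const (hN n (Finset.mem_Ico.1 hn).1)
  filter_upwards [h1, Ioo_mem_nhds (neg_lt_zero.2 hε) hε] with t ht htε n hn
  rcases lt_or_ge n N' with h | h
  · exact ht n (Finset.mem_Ico.2 ⟨hn, h⟩)
  · exact hN' n h t htε

/-- In the preferred chart at a fixed point `p`, the derivative of a `C¹` map is `mfderiv`, whose
source and target are both trivialized by that chart. -/
theorem exists_hasStrictFDerivAt_extChartAt_comp {g : M → M} {p : M}
    (hg : ContMDiff (𝓡 d) (𝓡 d) 1 g) (hgp : g p = p) :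
    ∃ A : EuclideanSpace ℝ (Fin d) →L[ℝ] EuclideanSpace ℝ (Fin d),
      (∀ v, A v = mfderiv (𝓡 d) (𝓡 d) g p v) ∧
      HasStrictFDerivAt (extChartAt (𝓡 d) p ∘ g ∘ (extChartAt (𝓡 d) p).symm) A
        (extChartAt (𝓡 d) p p) := by
  have h1 := (contMDiffAt_iff.1 (hg p)).2
  rw [ModelWithCorners.range_eq_univ, contDiffWithinAt_univ] at h1
  have h2 := h1.hasStrictFDerivAt one_ne_zero
  refine ⟨_, fun v => ?_, by rwa [hgp] at h2⟩
  have h3 := (hg.mdifferentiableAt one_ne_zero (x := p)).mfderiv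
  rw [ModelWithCorners.range_eq_univ, fderivWithin_univ, writtenInExtChartAt, hgp] at h3
  exact (DFunLike.congr_fun h3 v).symm

variable [IsManifold (𝓡 d) ∞ M]

theorem injective_mfderiv_extChartAt_comp_iterate (f : M ≃ₘ^1⟮𝓡 d, 𝓡 d⟯ M) {n : ℕ} {p z : M}
    (hz : f^[n] z ∈ (extChartAt (𝓡 d) p).source) :
    Function.Injective
      (mfderiv (𝓡 d) 𝓘(ℝ, EuclideanSpace ℝ (Fin d)) (extChartAt (𝓡 d) p ∘ f^[n]) z) := by
  rw [mfderiv_comp z (mdifferentiableAt_extChartAt (by simpa using hz))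
    (f.mdifferentiableAt_iterate n z)]
  exact (isInvertible_mfderiv_extChartAt hz).injective.comp
    (Function.LeftInverse.injective (f.mfderiv_symm_iterate_apply n z))

/-- A velocity at `z` is read off from the curve transported by `f^n` into the chart at `p`, through
an injective linear map `L` that depends neither on the curve nor on its velocity. -/
theorem exists_injective_hasDerivAt_extChartAt_iterate (f : M ≃ₘ^1⟮𝓡 d, 𝓡 d⟯ M) {n : ℕ} {p z : M}
    (hz : f^[n] z ∈ (extChartAt (𝓡 d) p).source) :
    ∃ L : EuclideanSpace ℝ (Fin d) →L[ℝ] EuclideanSpace ℝ (Fin d), Function.Injective L ∧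
      ∀ (γ : ℝ → M) (v : TangentSpace (𝓡 d) z), MDifferentiableAt 𝓘(ℝ, ℝ) (𝓡 d) γ 0 →
        (⟨γ 0, mfderiv 𝓘(ℝ, ℝ) (𝓡 d) γ 0 (1 : ℝ)⟩ : TangentBundle (𝓡 d) M) = ⟨z, v⟩ →
        HasDerivAt (fun t => extChartAt (𝓡 d) p (f^[n] (γ t))) (L v) 0 := by
  have hΦ : MDifferentiableAt (𝓡 d) 𝓘(ℝ, EuclideanSpace ℝ (Fin d))
      (extChartAt (𝓡 d) p ∘ f^[n]) z :=
    (mdifferentiableAt_extChartAt (by simpa using hz)).comp z (f.mdifferentiableAt_iterate _ z)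
  refine ⟨mfderiv (𝓡 d) 𝓘(ℝ, EuclideanSpace ℝ (Fin d)) (extChartAt (𝓡 d) p ∘ f^[n]) z,
    injective_mfderiv_extChartAt_comp_iterate f hz, fun γ v hγ hγv => ?_⟩
  obtain ⟨rfl, hv⟩ := (Bundle.TotalSpace.mk.injEq ..).mp hγv
  obtain rfl := eq_of_heq hv
  let D : ℝ →L[ℝ] EuclideanSpace ℝ (Fin d) :=
    (mfderiv (𝓡 d) 𝓘(ℝ, EuclideanSpace ℝ (Fin d)) (extChartAt (𝓡 d) p ∘ f^[n]) (γ 0)).comp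
      (mfderiv 𝓘(ℝ, ℝ) (𝓡 d) γ 0)
  have h1 : HasFDerivAt (fun t => extChartAt (𝓡 d) p (f^[n] (γ t))) D 0 :=
    (hΦ.hasMFDerivAt.comp 0 hγ.hasMFDerivAt).hasFDerivAt
  exact h1.hasDerivAt

variable [RiemannianBundle (fun x : M => TangentSpace (𝓡 d) x)]

/-- The tangent vectors of `W^s(p)` at `z` form a Lipschitz graph over a subset of a space of dimension
`dim E^s`. Two curves in `W^s(p)` through `z` are carried by a fixed power of `f` into the
neighbourhood of `p` where the cone estimate holds, which therefore passes to the difference of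
their velocities. -/
theorem IsHyperbolicSplitting.exists_dist_le_of_mem_stableTangent {f : M ≃ₘ^1⟮𝓡 d, 𝓡 d⟯ M}
    {p z : M} {Es Eu : ∀ x : M, Submodule ℝ (TangentSpace (𝓡 d) x)}
    (h : IsHyperbolicSplitting f p Es Eu) (hp : p ∈ Function.periodicPts f)
    (hz : z ∈ stableSet f.toEquiv p) :
    ∃ (F : Submodule ℝ (EuclideanSpace ℝ (Fin d))) (T : EuclideanSpace ℝ (Fin d) → F)
      (K : NNReal), Module.finrank ℝ F = Module.finrank ℝ (Es p) ∧
      ∀ v w : EuclideanSpace ℝ (Fin d), v ∈ stableTangent f p z → w ∈ stableTangent f p z →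
        dist v w ≤ K * dist (T v) (T w) := by
  -- a multiple `m` of the period for which `D(f^m)` at `p` is hyperbolic in the Euclidean norm
  obtain ⟨P, hP, hPp⟩ := hp
  obtain ⟨Ns, hNs, hs⟩ := h.stable.exists_euclidean_norm_le
  obtain ⟨Nu, hNu, hu⟩ := IsUniformlyContracted.exists_euclidean_norm_le
    (f := f.symm) (p := p) (V := Eu) (by rw [fullOrbit_symm]; exact h.unstable)
  set m := P * (Ns * Nu) with hm
  have hm1 : 1 ≤ m := Nat.one_le_iff_ne_zero.2 (by positivity)
  have hfix : ∀ k, f^[m * k] p = p := fun k => by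
    rw [hm, mul_assoc]
    exact (Function.IsPeriodicPt.mul_const hPp _)
  have hfixm : f^[m] p = p := by simpa using hfix 1
  have hfix_symm : f.symm^[m] p = p := by
    conv_lhs => rw [← hfixm]
    exact f.symm_iterate_apply_iterate m p
  set E₁ : Submodule ℝ (EuclideanSpace ℝ (Fin d)) := Es p
  set E₂ : Submodule ℝ (EuclideanSpace ℝ (Fin d)) := Eu p
  have hcompl : IsCompl E₁ E₂ := h.isCompl p (mem_fullOrbit_self f p)
  obtain ⟨A, hA, hAd⟩ :=
    exists_hasStrictFDerivAt_extChartAt_comp (f.contMDiff_iterate m) hfixm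
  -- the tangent spaces at `f^m p` and `p` are identified along the equality of the base points
  have hcast : ∀ (V : ∀ x : M, Submodule ℝ (TangentSpace (𝓡 d) x)) (y : M), y = p →
      ∀ w : EuclideanSpace ℝ (Fin d), w ∈ (V y : Submodule ℝ (EuclideanSpace ℝ (Fin d))) →
        w ∈ (V p : Submodule ℝ (EuclideanSpace ℝ (Fin d))) := by
    rintro V y rfl w hw; exact hw
  have hAs : ∀ v ∈ E₁, A v ∈ E₁ ∧ ‖A v‖ ≤ 1 / 2 * ‖v‖ := fun v hv =>
    hA v ▸ ⟨hcast Es _ hfixm _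
      (mfderiv_iterate_mem (fun x hx v hv => h.stable.mfderiv_mem hx hv) m hv),
      hs m ⟨P * Nu, by rw [hm]; ring⟩ hm1 hfixm v hv⟩
  have hAu_mem : ∀ v ∈ E₂, A v ∈ E₂ := fun v hv =>
    hA v ▸ hcast Eu _ hfixm _ (mfderiv_iterate_mem (fun x hx v hv => h.unstable.mfderiv_mem_of_symm
      (by
        obtain ⟨i, rfl⟩ := hx
        exact ⟨1 + i, by simp only [zpow_add, zpow_one]; rfl⟩) hv) m hv)
  have hAu : ∀ v ∈ E₂, A v ∈ E₂ ∧ ‖v‖ ≤ 1 / 2 * ‖A v‖ := fun v hv => by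
    refine ⟨hAu_mem v hv, ?_⟩
    have h1 := hu m ⟨P * Ns, by rw [hm]; ring⟩ hm1 hfix_symm (A v) (hAu_mem v hv)
    have h2 : ∀ y, y = p → ∀ w : EuclideanSpace ℝ (Fin d),
        (mfderiv (𝓡 d) (𝓡 d) f.symm^[m] y w : EuclideanSpace ℝ (Fin d)) =
          mfderiv (𝓡 d) (𝓡 d) f.symm^[m] p w := by
      rintro y rfl w; rfl
    rw [hA v] at h1 ⊢
    have h3 := (h2 _ hfixm _).symm.trans (f.mfderiv_symm_iterate_apply m p v)
    exact (congrArg (@norm (EuclideanSpace ℝ (Fin d)) _) h3).symm.le.trans h1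
  obtain ⟨U, hU, hUest⟩ := hAd.exists_nhds_norm_sub_le_of_hyperbolic hcompl hAs hAu
  have hW : (extChartAt (𝓡 d) p).source ∩ extChartAt (𝓡 d) p ⁻¹' U ∈ 𝓝 p :=
    inter_mem (extChartAt_source_mem_nhds p) ((continuousAt_extChartAt p).preimage_mem_nhds hU)
  obtain ⟨η, hη, hηW⟩ := EMetric.mem_nhds_iff.1 hW
  obtain ⟨N, hN⟩ := eventually_atTop.1 ((tendsto_order.1 hz).2 η hη)
  -- the sequence of times `m * (N + k)` runs through multiples of the period, all at least `N`
  have hmN : ∀ k, N ≤ m * (N + k) := fun k => by nlinarith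
  have hzW : f^[m * N] z ∈ (extChartAt (𝓡 d) p).source := by
    have h1 : edist (f^[m * N] z) (f^[m * N] p) < η := hN _ (hmN 0)
    rw [hfix] at h1
    exact (hηW h1).1
  obtain ⟨L, hLinj, hL⟩ := exists_injective_hasDerivAt_extChartAt_iterate f hzW
  obtain ⟨K, -, hK⟩ := L.toLinearMap.exists_antilipschitzWith (LinearMap.ker_eq_bot.2 hLinj)
  set B : EuclideanSpace ℝ (Fin d) →L[ℝ] E₁ :=
    LinearMap.toContinuousLinearMap (E₁.projectionOnto E₂ hcompl)
  have hcurve : ∀ v : EuclideanSpace ℝ (Fin d), v ∈ stableTangent f p z → ∃ γ : ℝ → M,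
      γ 0 = z ∧ HasDerivAt (fun t => extChartAt (𝓡 d) p (f^[m * (N + 0)] (γ t))) (L v) 0 ∧
      ∀ᶠ t in 𝓝 0, ∀ n ≥ N, edist (f^[n] (γ t)) (f^[n] p) < η := by
    rintro v ⟨ε, γ, hε, hγ, hγv, hunif⟩
    have hγd : MDifferentiableAt 𝓘(ℝ, ℝ) (𝓡 d) γ 0 :=
      (hγ.contMDiffAt (Ioo_mem_nhds (neg_lt_zero.2 hε) hε)).mdifferentiableAt one_ne_zero
    have h0 : γ 0 = z := congrArg Bundle.TotalSpace.proj hγv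
    exact ⟨γ, h0, hL γ v hγd hγv, eventually_forall_edist_iterate_lt f hε hγd.continuousAt hunif hη
      (by rw [h0]; exact hN)⟩
  refine ⟨E₁, fun v => B (L v), K * 2, rfl, fun v w hv hw => ?_⟩
  obtain ⟨γ₁, h₁0, h₁d, h₁e⟩ := hcurve v hv
  obtain ⟨γ₂, h₂0, h₂d, h₂e⟩ := hcurve w hw
  have hseq : ∀ γ : ℝ → M, ∀ t, (∀ n ≥ N, edist (f^[n] (γ t)) (f^[n] p) < η) →
      ∀ k, extChartAt (𝓡 d) p (f^[m * (N + k)] (γ t)) ∈ U ∧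
        extChartAt (𝓡 d) p (f^[m * (N + (k + 1))] (γ t)) =
          (extChartAt (𝓡 d) p ∘ f^[m] ∘ (extChartAt (𝓡 d) p).symm)
            (extChartAt (𝓡 d) p (f^[m * (N + k)] (γ t))) := by
    intro γ t ht k
    have h1 := ht _ (hmN k)
    rw [hfix] at h1
    have h2 := hηW h1
    refine ⟨h2.2, ?_⟩
    simp only [Function.comp_apply]
    rw [(extChartAt (𝓡 d) p).left_inv h2.1, ← Function.iterate_add_apply]
    congr 3
    ring
  have hest : ‖L v - L w‖ ≤ 2 * ‖B (L v - L w)‖ := by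
    refine (h₁d.sub h₂d).norm_le_of_eventually_norm_le ?_ B ?_
    · simp [h₁0, h₂0]
    · filter_upwards [h₁e, h₂e] with t ht₁ ht₂
      exact hUest (fun k => extChartAt (𝓡 d) p (f^[m * (N + k)] (γ₁ t)))
        (fun k => extChartAt (𝓡 d) p (f^[m * (N + k)] (γ₂ t))) (hseq γ₁ t ht₁) (hseq γ₂ t ht₂)
  calc dist v w ≤ K * dist (L v) (L w) := hK.le_mul_dist v w
    _ ≤ K * (2 * dist (B (L v)) (B (L w))) := by
      rw [dist_eq_norm, dist_eq_norm, ← map_sub B]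
      gcongr
    _ = _ := by push_cast; ring

end Chart

/-! ### Shadowing and comparison of indices -/

/-- Joining the backward orbit of `q` to the forward orbit of `p` gives a pseudo-orbit with a single
jump; a point shadowing it lies in `W^s(p) ∩ W^u(q)`. -/
theorem HasTwoSidedLimitShadowing.nonempty_inter {X : Type*} [PseudoEMetricSpace X]
    {f : Equiv.Perm X} (hf : HasTwoSidedLimitShadowing f) (p q : X) :
    (stableSet f p ∩ stableSet f⁻¹ q).Nonempty := by
  obtain ⟨y, hy⟩ := hf (fun i => if 0 ≤ i then (f ^ i) p else (f ^ i) q) (by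
    refine tendsto_nhds_of_eventually_eq ?_
    -- the only jump is from time `-1` to time `0`
    filter_upwards [(finite_singleton (-1 : ℤ)).compl_mem_cofinite] with i hi
    have hi' : i ≠ -1 := hi
    rcases le_or_gt 0 i with h | h
    · rw [if_pos h, if_pos (by omega), ← Equiv.Perm.mul_apply, ← zpow_one_add, add_comm, edist_self]
    · rw [if_neg (by omega), if_neg (by omega), ← Equiv.Perm.mul_apply, ← zpow_one_add, add_comm,
        edist_self])
  refine ⟨y, ?_, ?_⟩
  · have hinj : Function.Injective fun n : ℕ => (n : ℤ) := Nat.cast_injective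
    have h := hy.comp hinj.tendsto_cofinite
    rw [Nat.cofinite_eq_atTop] at h
    refine h.congr fun n => ?_
    simp [Equiv.Perm.iterate_eq_pow]
  · have hinj : Function.Injective fun n : ℕ => -(n : ℤ) := fun a b h => by simpa using h
    have h := hy.comp hinj.tendsto_cofinite
    rw [Nat.cofinite_eq_atTop] at h
    refine h.congr' ?_
    filter_upwards [eventually_ge_atTop 1] with n hn
    have hneg : ¬ (0 : ℤ) ≤ -(n : ℤ) := by omega
    rw [Function.comp_apply, if_neg hneg, zpow_neg, zpow_natCast, ← inv_pow,
      Equiv.Perm.iterate_eq_pow]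

section Index

variable {d : ℕ} {M : Type*} [EMetricSpace M] [ChartedSpace (EuclideanSpace ℝ (Fin d)) M]

theorem Diffeomorph.mem_periodicPts_symm {f : M ≃ₘ^1⟮𝓡 d, 𝓡 d⟯ M} {p : M}
    (hp : p ∈ Function.periodicPts f) : p ∈ Function.periodicPts f.symm := by
  obtain ⟨n, hn, hpn⟩ := hp
  refine ⟨n, hn, ?_⟩
  have h := f.symm_iterate_apply_iterate n p
  rwa [hpn] at h

variable [IsManifold (𝓡 d) ∞ M] [RiemannianBundle (fun x : M => TangentSpace (𝓡 d) x)]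

theorem finrank_le_of_stableUnstableTransversal {f : M ≃ₘ^1⟮𝓡 d, 𝓡 d⟯ M}
    (hTLS : HasTwoSidedLimitShadowing f.toEquiv) {p q : M}
    (hp : p ∈ Function.periodicPts f) (hq : q ∈ Function.periodicPts f)
    (hpq : StableUnstableTransversal f p q)
    {Es Eu Es' Eu' : ∀ x : M, Submodule ℝ (TangentSpace (𝓡 d) x)}
    (h : IsHyperbolicSplitting f p Es Eu) (h' : IsHyperbolicSplitting f q Es' Eu') :
    Module.finrank ℝ (Es' q) ≤ Module.finrank ℝ (Es p) := by
  obtain ⟨z, hz⟩ := hTLS.nonempty_inter p q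
  obtain ⟨F₁, T₁, K₁, hF₁, h₁⟩ := h.exists_dist_le_of_mem_stableTangent hp hz.1
  obtain ⟨F₂, T₂, K₂, hF₂, h₂⟩ :=
    h'.symm.exists_dist_le_of_mem_stableTangent (Diffeomorph.mem_periodicPts_symm hq) hz.2
  have hdim := finrank_le_add_of_forall_exists_add
    (E := EuclideanSpace ℝ (Fin d)) (S₁ := stableTangent f p z)
    (S₂ := stableTangent f.symm q z) (fun v hv w hw => h₁ v w hv hw)
    (fun v hv w hw => h₂ v w hv hw) (hpq z hz)
  have hsum : Module.finrank ℝ (Es' q) + Module.finrank ℝ (Eu' q) =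
      Module.finrank ℝ (EuclideanSpace ℝ (Fin d)) := by
    have hfin : ∀ U W : Submodule ℝ (EuclideanSpace ℝ (Fin d)), IsCompl U W →
        Module.finrank ℝ U + Module.finrank ℝ W = Module.finrank ℝ (EuclideanSpace ℝ (Fin d)) :=
      fun _ _ hc => Submodule.finrank_add_eq_of_isCompl hc
    exact hfin _ _ (h'.isCompl q (mem_fullOrbit_self f q))
  omega
end Index

theorem mainTheorem9 {d : ℕ} {M : Type*} [EMetricSpace M] [CompactSpace M]
    [ChartedSpace (EuclideanSpace ℝ (Fin d)) M] [IsManifold (𝓡 d) ∞ M]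
    [RiemannianBundle (fun x : M => TangentSpace (𝓡 d) x)]
    [IsContMDiffRiemannianBundle (𝓡 d) ∞ (EuclideanSpace ℝ (Fin d))
      (fun x : M => TangentSpace (𝓡 d) x)]
    [IsRiemannianManifold (𝓡 d) M]
    (f : M ≃ₘ^1⟮𝓡 d, 𝓡 d⟯ M)
    (hKS : IsKupkaSmale f) (hTLS : HasTwoSidedLimitShadowing f.toEquiv) :
    ∃ k : ℕ, ∀ p ∈ Function.periodicPts f, ∀ m : ℕ, HasIndex f p m ↔ m = k := by
  rcases (Function.periodicPts f).eq_empty_or_nonempty with hempty | ⟨q, hq⟩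
  · exact ⟨0, fun p hp => by simp [hempty] at hp⟩
  obtain ⟨-, Fs, Fu, hF⟩ := hKS.1 q hq
  have hindex : ∀ p ∈ Function.periodicPts f, ∀ Es Eu, IsHyperbolicSplitting f p Es Eu →
      Module.finrank ℝ (Es p) = Module.finrank ℝ (Fs q) := fun p hp Es Eu hE =>
    le_antisymm
      (finrank_le_of_stableUnstableTransversal hTLS hq hp (hKS.2 q hq p hp) hF hE)
      (finrank_le_of_stableUnstableTransversal hTLS hp hq (hKS.2 p hp q hq) hE hF)
  refine ⟨Module.finrank ℝ (Fs q), fun p hp m => ⟨?_, ?_⟩⟩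
  · rintro ⟨-, Es, Eu, hE, rfl⟩
    exact hindex p hp Es Eu hE
  · rintro rfl
    obtain ⟨-, Es, Eu, hE⟩ := hKS.1 p hp
    exact ⟨hp, Es, Eu, hE, hindex p hp Es Eu hE⟩
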